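/- Let $m\ge 2$ and $n\ge 1$ be integers. A real tensor $\mathcal A=(A_{i_1\cdots i_m})$ of order $m$ and dimension $n$ is nonnegative (positive) if all its entries are. For a vector $x$ with $n$ entries put $$(\mathcal A x^{m-1})_i=\sum_{i_2,\dots,i_m=1}^n A_{i i_2\cdots i_m}x_{i_2}\cdots x_{i_m},\qquad (\mathcal A x^{m-2})_{ij}=\sum_{i_3,\dots,i_m=1}^n A_{i j i_3\cdots i_m}x_{i_3}\cdots x_{i_m},\qquad x^{[\alpha]}=(x_1^\alpha,\dots,x_n^\alpha)^T .$$ A pair $(\lambda,x)\in\mathbb C\times(\mathbb C^n\setminus\{0\})$ is an eigenpair of $\mathcal A$ if $\mathcal A x^{m-1}=\lambda x^{[m-1]}$; the spectral radius $\rho(\mathcal A)$ is the maximum of $|\lambda|$ over all eigenvalues $\lambda$. The tensor $\mathcal A$ is reducible if there is a nonempty proper subset $I$ of $\{1,\dots,n\}$ with $A_{i_1 i_2\cdots i_m}=0$ for all $i_1\in I$ and all $i_2,\dots,i_m\notin I$, and irreducible otherwise. A Perron pair of a nonnegative tensor $\mathcal A$ is a pair $(\lambda,x)$ with $\lambda=\rho(\mathcal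 A)$ and $x$ a nonnegative eigenvector for $\lambda$ with $x^Tx=1$. Let $\bar{\mathcal A}$ be the partial symmetrization of $\mathcal A$ in its last $m-1$ indices, that is, $\bar A_{i_1i_2\cdots i_m}=\frac1{(m-1)!}\sum_\pi A_{i_1\pi(i_2\cdots i_m)}$, the sum being over all permutations $\pi$ of $i_2,\dots,i_m$. Let $\mathcal A$ be a nonnegative tensor of order $m$ and dimension $n$, let $a,b\in\mathbb R^n_{++}$ be entrywise positive vectors, let $\mathcal E$ be the tensor with entries $E_{i_1\cdots i_m}=a_{i_1}^{m-1}b_{i_2}\cdots b_{i_m}$, let $\mathcal B_t=t\mathcal A+(1-t)\mathcal E$, and let $$P(\lambda,x)=\begin{pmatrix}\mathcal A x^{m-1}-\lambda x^{[m-1]}\\ x^Tx-1\end{pmatrix},\quad Q(\lambda,x)=\begin{pmatrix}\mathcal E x^{m-1}-\lambda x^{[m-1]}\\ x^Tx-1\end{pmatrix},\quad H(\lambda,x,t)=(1-t)Q(\lambda,x)+tP(\lambda,x).$$ (a) For every $t\in[0,1)$ the tensor $\mathcal B_t$ is positive, and $H(\lambda,x,t)=0$ has a unique solution $(\lambda(t),x(t))$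 in $\mathbb R_{++}\times\mathbb R^n_{++}$, which is the (unique) Perron pair of $\mathcal B_t$. Moreover, the Jacobian matrix $$D_{(\lambda,x)}H(\lambda(t),x(t),t)=\begin{pmatrix}-x(t)^{[m-1]} & (m-1)\bigl[\bar{\mathcal B}_t x(t)^{m-2}-\lambda(t)C(t)\bigr]\\ 0 & 2x(t)^T\end{pmatrix},\qquad C(t)=\operatorname{diag}\bigl(x_1(t)^{m-2},\dots,x_n(t)^{m-2}\bigr),$$ has rank $n+1$. (b) If furthermore $\mathcal A$ is irreducible and $\mathcal A\ne 0$ (the latter being automatic when $n\ge 2$), then $H(\lambda,x,1)=P(\lambda,x)=0$ has a unique solution $(\lambda_*,x_*)$ in $\mathbb R_{++}\times\mathbb R^n_{++}$, which is the (unique) Perron pair of $\mathcal A$. Moreover, the Jacobian matrix $$D_{(\lambda,x)}H(\lambda_*,x_*,1)=\begin{pmatrix}-x_*^{[m-1]} & (m-1)\bigl[\bar{\mathcal A} x_*^{m-2}-\lambda_*C_*\bigr]\\ 0 & 2x_*^T\end{pmatrix},\qquad C_*=\operatorname{diag}\bigl(x_{*1}^{m-2},\dots,x_{*n}^{m-2}\bigr),$$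 has rank $n+1$. -/

import Mathlib

noncomputable section

namespace TensorHomotopy

/-- Real tensors of order `m` and dimension `n`, given by their entries `A_{i₁ … i_m}`. Below the
order is written `m = k + 2`, so that `m - 1 = k + 1` and `m - 2 = k`. -/
abbrev RTensor (m n : ℕ) : Type := (Fin m → Fin n) → ℝ

variable {k n : ℕ}

/-- The vector `A x^{m-1}`, for `x` with real or complex entries:
`(A x^{m-1})_i = ∑ A_{i i₂ … i_m} x_{i₂} ⋯ x_{i_m}`. -/
def mulPow {R : Type*} [CommRing R] [Algebra ℝ R] (A : RTensor (k + 2) n) (x : Fin n → R) :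
    Fin n → R :=
  fun i => ∑ j : Fin (k + 1) → Fin n, A (Fin.cons i j) • ∏ s, x (j s)

/-- The matrix `A x^{m-2}`, with entries
`(A x^{m-2})_{i j} = ∑ A_{i j i₃ … i_m} x_{i₃} ⋯ x_{i_m}`. -/
def mulPowMatrix (A : RTensor (k + 2) n) (x : Fin n → ℝ) : Matrix (Fin n) (Fin n) ℝ :=
  Matrix.of fun i j => ∑ l : Fin k → Fin n, A (Fin.cons i (Fin.cons j l)) * ∏ s, x (l s)

/-- `(μ, x)` is an eigenpair: `x ≠ 0` and `A x^{m-1} = μ x^{[m-1]}`, over the complex numbers. -/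
def IsEigenpair (A : RTensor (k + 2) n) (μ : ℂ) (x : Fin n → ℂ) : Prop :=
  x ≠ 0 ∧ mulPow A x = fun i => μ * x i ^ (k + 1)

/-- `r` is the spectral radius of `A`: the maximum of `|μ|` over all complex eigenvalues `μ`. -/
def IsSpectralRadius (A : RTensor (k + 2) n) (r : ℝ) : Prop :=
  IsGreatest {c : ℝ | ∃ (μ : ℂ) (x : Fin n → ℂ), IsEigenpair A μ x ∧ c = ‖μ‖} r

/-- `A` is reducible: for some nonempty proper set `I` of indices, `A_{i₁ i₂ … i_m} = 0` whenever
`i₁ ∈ I` and `i₂, …, i_m ∉ I`. -/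
def IsReducible (A : RTensor (k + 2) n) : Prop :=
  ∃ I : Set (Fin n), I.Nonempty ∧ I ≠ Set.univ ∧
    ∀ i ∈ I, ∀ j : Fin (k + 1) → Fin n, (∀ s, j s ∉ I) → A (Fin.cons i j) = 0

/-- `(r, x)` is a Perron pair of `A`: `r` is the spectral radius of `A`, and `x` is a nonnegative
eigenvector of `A` for the eigenvalue `r`, with `xᵀ x = 1`. -/
def IsPerronPair (A : RTensor (k + 2) n) (r : ℝ) (x : Fin n → ℝ) : Prop :=
  IsSpectralRadius A r ∧ IsEigenpair A (r : ℂ) (fun i => (x i : ℂ)) ∧ (∀ i, 0 ≤ x i) ∧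
    x ⬝ᵥ x = 1

/-- The tensor `E = a^{[m-1]} ∘ b ∘ ⋯ ∘ b`, with entries `a_{i₁}^{m-1} b_{i₂} ⋯ b_{i_m}`. -/
def startTensor (k : ℕ) (a b : Fin n → ℝ) : RTensor (k + 2) n :=
  fun i => a (i 0) ^ (k + 1) * ∏ s : Fin (k + 1), b (i s.succ)

/-- The map `(r, x) ↦ (A x^{m-1} - r x^{[m-1]}, xᵀ x - 1)`. -/
def eigenSystem (A : RTensor (k + 2) n) (r : ℝ) (x : Fin n → ℝ) : (Fin n → ℝ) × ℝ :=
  (fun i => mulPow A x i - r * x i ^ (k + 1), x ⬝ᵥ x - 1)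

/-- The homotopy `H(r, x, t) = (1 - t) Q(r, x) + t P(r, x)` from the system `Q` of the tensor `E` to
the system `P` of the tensor `A`. -/
def homotopy (A : RTensor (k + 2) n) (a b : Fin n → ℝ) (r : ℝ) (x : Fin n → ℝ) (t : ℝ) :
    (Fin n → ℝ) × ℝ :=
  (1 - t) • eigenSystem (startTensor k a b) r x + t • eigenSystem A r x

/-- The tensor `B_t = t A + (1 - t) E`. -/
def pathTensor (A : RTensor (k + 2) n) (a b : Fin n → ℝ) (t : ℝ) : RTensor (k + 2) n :=
  t • A + (1 - t) • startTensor k a b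

/-- Partial symmetrization of `A` in the indices `i₂, …, i_m`. -/
def partialSymm (A : RTensor (k + 2) n) : RTensor (k + 2) n :=
  fun i => (1 / (Nat.factorial (k + 1) : ℝ)) *
    ∑ π : Equiv.Perm (Fin (k + 1)), A (Fin.cons (i 0) fun s => i (π s).succ)

/-- The set of solutions `(r, x)` of `H(r, x, t) = 0` with `r > 0` and `x` entrywise positive. -/
def positiveSolutions (A : RTensor (k + 2) n) (a b : Fin n → ℝ) (t : ℝ) :
    Set (ℝ × (Fin n → ℝ)) :=
  {p | 0 < p.1 ∧ (∀ i, 0 < p.2 i) ∧ homotopy A a b p.1 p.2 t = 0}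

/-- The Jacobian matrix `D_{(r,x)} F` at `p` of a map `F` of `(r, x)`: the matrix of the derivative
in the standard bases. The columns are indexed by `r` followed by the coordinates of `x`. -/
def jacobian (F : ℝ × (Fin n → ℝ) → (Fin n → ℝ) × ℝ) (p : ℝ × (Fin n → ℝ)) :
    Matrix (Fin n ⊕ Unit) (Unit ⊕ Fin n) ℝ :=
  LinearMap.toMatrix
    ((Module.Basis.singleton Unit ℝ).prod (Pi.basisFun ℝ (Fin n)))
    ((Pi.basisFun ℝ (Fin n)).prod (Module.Basis.singleton Unit ℝ))
    (fderiv ℝ F p : ℝ × (Fin n → ℝ) →ₗ[ℝ] (Fin n → ℝ) × ℝ)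

/-- The block matrix with first block row `-x^{[m-1]}`, `(m-1) (B̄ x^{m-2} - r C)`, and second block
row `0`, `2 xᵀ`; here `B̄` is the partial symmetrization of `B` and `C = diag(x_i^{m-2})`. -/
def jacobianFormula (B : RTensor (k + 2) n) (r : ℝ) (x : Fin n → ℝ) :
    Matrix (Fin n ⊕ Unit) (Unit ⊕ Fin n) ℝ :=
  Matrix.fromBlocks
    (Matrix.replicateCol Unit fun i => -(x i ^ (k + 1)))
    (((k : ℝ) + 1) • (mulPowMatrix (partialSymm B) x - r • Matrix.diagonal fun i => x i ^ k))
    0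
    (Matrix.replicateRow Unit ((2 : ℝ) • x))

end TensorHomotopy

end

namespace TensorHomotopy

open Filter Topology

/-! ### Perron–Frobenius theory for irreducible nonnegative tensors -/

section Perron

variable {k n : ℕ} {A : RTensor (k + 2) n}

/-! The eigenvalue system is affine in the tensor, so `H(·, ·, t)` is the system of `B_t`
(`homotopy_eq_eigenSystem`). Both claims thus reduce to one statement about a nonzero irreducible
nonnegative tensor, applied to the positive tensor `B_t` or to `A` itself.

Existence is of Collatz–Wielandt type: among subinvariant pairs take the largest factor `r`. If the
vector were not an eigenvector, irreducibility would spread strictness to every index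
(`IsSubinvariant.exists_strict`), and `r` could be raised. Such an eigenvector is positive, its
eigenvalue bounds every complex eigenvalue (`IsEigenpair.norm_le`), and it is unique up to scale:
take the largest multiple of one positive eigenvector below another and look at the contact set.

For the Jacobian, symmetrization makes all `m - 1` terms of the product rule equal. Writing a kernel
vector's `x`-part as `v_i = x_i w_i`, a minimum and maximum principle for `w` forces `v` to be a
multiple of `x` (`linearized_eigenSystem`). The last row `2 xᵀ` kills that multiple, so the square
matrix is injective. -/

lemma mulPow_real_apply (A : RTensor (k + 2) n) (x : Fin n → ℝ) (i : Fin n) :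
    mulPow A x i = ∑ j : Fin (k + 1) → Fin n, A (Fin.cons i j) * ∏ s, x (j s) := by
  simp [mulPow]

lemma continuous_mulPow (A : RTensor (k + 2) n) :
    Continuous (fun x : Fin n → ℝ => mulPow A x) := by
  refine continuous_pi fun i => ?_
  simp only [mulPow_real_apply]
  fun_prop

lemma mulPow_smul (A : RTensor (k + 2) n) (c : ℝ) (x : Fin n → ℝ) (i : Fin n) :
    mulPow A (c • x) i = c ^ (k + 1) * mulPow A x i := by
  simp only [mulPow_real_apply, Pi.smul_apply, smul_eq_mul, Finset.prod_mul_distrib,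
    Finset.prod_const, Finset.card_univ, Fintype.card_fin, Finset.mul_sum]
  exact Finset.sum_congr rfl fun j _ => by ring

lemma mulPow_mono (hA : ∀ i, 0 ≤ A i) {x y : Fin n → ℝ} (hx : ∀ i, 0 ≤ x i)
    (hxy : ∀ i, x i ≤ y i) (i : Fin n) : mulPow A x i ≤ mulPow A y i := by
  simp only [mulPow_real_apply]
  exact Finset.sum_le_sum fun j _ => mul_le_mul_of_nonneg_left
    (Finset.prod_le_prod (fun s _ => hx _) fun s _ => hxy _) (hA _)

lemma prod_lt_prod_of_nonneg {ι : Type*} {s : Finset ι} (hs : s.Nonempty) {f g : ι → ℝ}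
    (hf : ∀ i ∈ s, 0 ≤ f i) (hfg : ∀ i ∈ s, f i < g i) : ∏ i ∈ s, f i < ∏ i ∈ s, g i := by
  by_cases h : ∃ i ∈ s, f i = 0
  · rw [Finset.prod_eq_zero_iff.2 h]
    exact Finset.prod_pos fun i hi => (hf i hi).trans_lt (hfg i hi)
  · push Not at h
    exact Finset.prod_lt_prod_of_nonempty
      (fun i hi => lt_of_le_of_ne (hf i hi) (h i hi).symm) hfg hs

lemma mulPow_lt_mulPow (hA : ∀ i, 0 ≤ A i) {x y : Fin n → ℝ} (hx : ∀ i, 0 ≤ x i)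
    (hxy : ∀ i, x i ≤ y i) {i : Fin n} {j : Fin (k + 1) → Fin n} (hj : 0 < A (Fin.cons i j))
    (hlt : ∀ s, x (j s) < y (j s)) : mulPow A x i < mulPow A y i := by
  simp only [mulPow_real_apply]
  exact Finset.sum_lt_sum (fun j _ => mul_le_mul_of_nonneg_left
    (Finset.prod_le_prod (fun s _ => hx _) fun s _ => hxy _) (hA _))
    ⟨j, Finset.mem_univ _, mul_lt_mul_of_pos_left
      (prod_lt_prod_of_nonneg Finset.univ_nonempty (fun s _ => hx _) fun s _ => hlt s) hj⟩

lemma mulPow_zero (A : RTensor (k + 2) n) (i : Fin n) : mulPow A (0 : Fin n → ℝ) i = 0 := by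
  simp [mulPow_real_apply]

lemma mulPow_nonneg (hA : ∀ i, 0 ≤ A i) {x : Fin n → ℝ} (hx : ∀ i, 0 ≤ x i) (i : Fin n) :
    0 ≤ mulPow A x i := by
  simpa [mulPow_zero] using mulPow_mono hA (x := 0) (fun _ => le_rfl) hx i

/-- The form in which irreducibility is used: `I` will be a set of indices where some equality
holds, and the entry found forces a strict inequality at an index of `I`. -/
lemma exists_entry_pos (hA : ∀ i, 0 ≤ A i) (hirr : ¬ IsReducible A) {I : Set (Fin n)}
    (hI : I.Nonempty) (hI' : I ≠ Set.univ) :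
    ∃ i ∈ I, ∃ j : Fin (k + 1) → Fin n, (∀ s, j s ∉ I) ∧ 0 < A (Fin.cons i j) := by
  by_contra! h
  exact hirr ⟨I, hI, hI', fun i hi j hj => le_antisymm (h i hi j hj) (hA _)⟩

lemma pos_of_nonneg_eigenvector (hA : ∀ i, 0 ≤ A i) (hirr : ¬ IsReducible A) {r : ℝ}
    {x : Fin n → ℝ} (hx : ∀ i, 0 ≤ x i) (hx0 : x ≠ 0)
    (h : ∀ i, mulPow A x i = r * x i ^ (k + 1)) (i : Fin n) : 0 < x i := by
  by_contra hi
  obtain ⟨i, hi, j, hj, hpos⟩ := exists_entry_pos hA hirr (I := {i | x i = 0})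
    ⟨i, le_antisymm (not_lt.1 hi) (hx i)⟩
    (fun hu => hx0 (funext fun i => (hu ▸ Set.mem_univ i : i ∈ {i | x i = 0})))
  have := mulPow_lt_mulPow hA (x := 0) (fun _ => le_rfl) hx hpos
    fun s => lt_of_le_of_ne (hx _) (Ne.symm (hj s))
  rw [h, mulPow_zero, show x i = 0 from hi] at this
  simp at this

/-- Nonvanishing is a separate hypothesis because for `n = 1` every tensor, even zero, is
irreducible. -/
lemma eigenvalue_pos (hA : ∀ i, 0 ≤ A i) (hA0 : A ≠ 0) {r : ℝ} {x : Fin n → ℝ}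
    (hx : ∀ i, 0 < x i) (h : ∀ i, mulPow A x i = r * x i ^ (k + 1)) : 0 < r := by
  obtain ⟨l, hl⟩ := Function.ne_iff.1 hA0
  have := mulPow_lt_mulPow hA (x := 0) (y := x) (i := l 0) (j := Fin.tail l) (fun _ => le_rfl)
    (fun i => (hx i).le)
    (by rw [Fin.cons_self_tail]; exact lt_of_le_of_ne (hA _) (Ne.symm hl)) fun s => hx _
  rw [h, mulPow_zero] at this
  exact pos_of_mul_pos_left this (pow_pos (hx _) _).le

/-- Subinvariance with factor `r`: `r x^{[m-1]} ≤ A x^{m-1}` for a nonzero nonnegative `x`. -/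
def IsSubinvariant (A : RTensor (k + 2) n) (r : ℝ) (x : Fin n → ℝ) : Prop :=
  (∀ i, 0 ≤ x i) ∧ x ≠ 0 ∧ ∀ i, r * x i ^ (k + 1) ≤ mulPow A x i

lemma IsSubinvariant.smul {r c : ℝ} {x : Fin n → ℝ} (h : IsSubinvariant A r x) (hc : 0 < c) :
    IsSubinvariant A r (c • x) := by
  refine ⟨fun i => mul_nonneg hc.le (h.1 i), smul_ne_zero hc.ne' h.2.1, fun i => ?_⟩
  rw [mulPow_smul, Pi.smul_apply, smul_eq_mul, mul_pow, mul_left_comm]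
  exact mul_le_mul_of_nonneg_left (h.2.2 i) (pow_pos hc _).le

lemma exists_pos_coord {x : Fin n → ℝ} (hx : ∀ i, 0 ≤ x i) (hx0 : x ≠ 0) : ∃ i, 0 < x i := by
  obtain ⟨i, hi⟩ := Function.ne_iff.1 hx0
  exact ⟨i, lt_of_le_of_ne (hx i) (Ne.symm hi)⟩

/-- Compare at a largest coordinate of `x`. This bound makes the set of normalized subinvariant
pairs compact. -/
lemma IsSubinvariant.le_sum (hA : ∀ i, 0 ≤ A i) {r : ℝ} {x : Fin n → ℝ}
    (h : IsSubinvariant A r x) :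
    r ≤ ∑ i : Fin n, ∑ j : Fin (k + 1) → Fin n, A (Fin.cons i j) := by
  obtain ⟨i₀, hi₀⟩ := exists_pos_coord h.1 h.2.1
  obtain ⟨i, -, hi⟩ := Finset.exists_max_image Finset.univ x ⟨i₀, Finset.mem_univ _⟩
  have hpos : 0 < x i := hi₀.trans_le (hi _ (Finset.mem_univ _))
  have h1 : mulPow A x i ≤ (∑ j : Fin (k + 1) → Fin n, A (Fin.cons i j)) * x i ^ (k + 1) := by
    refine (mulPow_mono hA h.1 (y := fun _ => x i) (fun l => hi l (Finset.mem_univ _)) i).trans ?_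
    simp [mulPow_real_apply, Finset.sum_mul]
  have h2 := le_of_mul_le_mul_right ((h.2.2 i).trans h1) (pow_pos hpos _)
  exact h2.trans (Finset.single_le_sum
    (f := fun i : Fin n => ∑ j : Fin (k + 1) → Fin n, A (Fin.cons i j))
    (fun i _ => Finset.sum_nonneg fun j _ => hA _) (Finset.mem_univ i))

lemma exists_max_subinvariant (hn : 1 ≤ n) (hA : ∀ i, 0 ≤ A i) :
    ∃ (r : ℝ) (x : Fin n → ℝ), IsSubinvariant A r x ∧
      ∀ s y, IsSubinvariant A s y → s ≤ r := by
  set M := ∑ i : Fin n, ∑ j : Fin (k + 1) → Fin n, A (Fin.cons i j) with hM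
  have hM0 : 0 ≤ M := Finset.sum_nonneg fun i _ => Finset.sum_nonneg fun j _ => hA _
  let K : Set (ℝ × (Fin n → ℝ)) := (Set.Icc 0 M ×ˢ stdSimplex ℝ (Fin n)) ∩
    {p | ∀ i, p.1 * p.2 i ^ (k + 1) ≤ mulPow A p.2 i}
  have hK : IsCompact K := by
    refine (isCompact_Icc.prod (isCompact_stdSimplex ℝ (Fin n))).inter_right ?_
    simp only [Set.ofPred_forall]
    refine isClosed_iInter fun i => isClosed_le (by fun_prop) ?_
    exact (continuous_apply i).comp ((continuous_mulPow A).comp continuous_snd)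
  have hne : K.Nonempty := by
    refine ⟨(0, Pi.single ⟨0, hn⟩ 1), ⟨⟨le_rfl, hM0⟩, single_mem_stdSimplex ℝ _⟩, fun i => ?_⟩
    simpa using mulPow_nonneg hA (single_mem_stdSimplex ℝ (⟨0, hn⟩ : Fin n)).1 i
  obtain ⟨p, hp, hmax⟩ := hK.exists_isMaxOn hne continuous_fst.continuousOn
  refine ⟨p.1, p.2, ⟨hp.1.2.1, ?_, hp.2⟩, fun s y hy => ?_⟩
  · intro h0
    simpa [h0] using hp.1.2.2
  · obtain hs | hs := le_total s 0
    · exact hs.trans hp.1.1.1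
    obtain ⟨i₀, hi₀⟩ := exists_pos_coord hy.1 hy.2.1
    have hsum : 0 < ∑ i, y i :=
      Finset.sum_pos' (fun i _ => hy.1 i) ⟨i₀, Finset.mem_univ _, hi₀⟩
    have hy' := hy.smul (inv_pos.2 hsum)
    refine hmax (show (s, (∑ i, y i)⁻¹ • y) ∈ K from
      ⟨⟨⟨hs, hy.le_sum hA⟩, hy'.1, ?_⟩, hy'.2.2⟩)
    simp [← Finset.mul_sum, inv_mul_cancel₀ hsum.ne']

/-- A subinvariant vector that is strictly subinvariant somewhere can be replaced by one that is
strictly subinvariant everywhere. -/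
lemma IsSubinvariant.exists_strict (hA : ∀ i, 0 ≤ A i) (hirr : ¬ IsReducible A) {r : ℝ}
    {x : Fin n → ℝ} (hx : IsSubinvariant A r x) (hJ : ∃ i, r * x i ^ (k + 1) < mulPow A x i) :
    ∃ y, IsSubinvariant A r y ∧ ∀ i, r * y i ^ (k + 1) < mulPow A y i := by
  -- Induction on the set `J` of strict indices, growing it until it is everything; it terminates as
  -- there are finitely many indices.
  induction hJx : {i | r * x i ^ (k + 1) < mulPow A x i} using
    (wellFounded_gt (α := Set (Fin n))).induction generalizing x with
  | _ J ih =>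
    by_cases hJu : J = Set.univ
    · exact ⟨x, hx, fun i => (hJx.trans hJu ▸ Set.mem_univ i :
        i ∈ {i | r * x i ^ (k + 1) < mulPow A x i})⟩
    have hmemJ : ∀ i, i ∈ J ↔ r * x i ^ (k + 1) < mulPow A x i := fun i => by rw [← hJx]; rfl
    -- Raise `x` slightly on `J` only: strictness on `J` survives by continuity, and off `J` the
    -- right side can only grow while the left is unchanged.
    let y : ℝ → Fin n → ℝ := fun ε i => x i + ε * J.indicator 1 i
    have hy : Continuous y := by fun_prop
    have hy0 : y 0 = x := by funext i; simp [y]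
    have hev : ∀ᶠ ε in 𝓝[>] (0 : ℝ), ∀ i ∈ J, r * y ε i ^ (k + 1) < mulPow A (y ε) i := by
      refine Filter.eventually_all.2 fun i => ?_
      by_cases hi : i ∈ J
      · have h1 : Continuous fun ε => r * y ε i ^ (k + 1) := by fun_prop
        have h2 : Continuous fun ε => mulPow A (y ε) i :=
          (continuous_apply i).comp ((continuous_mulPow A).comp hy)
        have := h1.continuousAt.eventually_lt h2.continuousAt (x₀ := (0 : ℝ))
          (by simpa [hy0] using (hmemJ i).1 hi)
        exact (this.filter_mono nhdsWithin_le_nhds).mono fun ε h _ => h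
      · exact Eventually.of_forall fun ε h => absurd h hi
    obtain ⟨ε, hε, hε0⟩ := (hev.and self_mem_nhdsWithin).exists
    have hε0 : 0 < ε := hε0
    have hle : ∀ i, x i ≤ y ε i := fun i =>
      le_add_of_nonneg_right (mul_nonneg hε0.le (Set.indicator_nonneg (fun _ _ => zero_le_one) i))
    have hout : ∀ i, i ∉ J → y ε i = x i := fun i hi => by simp [y, hi]
    have hin : ∀ i, i ∈ J → x i < y ε i := fun i hi => by simpa [y, hi] using hε0
    have hsub : IsSubinvariant A r (y ε) := by
      obtain ⟨i₀, hi₀⟩ := exists_pos_coord hx.1 hx.2.1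
      refine ⟨fun i => (hx.1 i).trans (hle i), fun h => ?_, fun i => ?_⟩
      · have := hi₀.trans_le (hle i₀)
        simp [h] at this
      · by_cases hi : i ∈ J
        · exact (hε i hi).le
        · rw [hout i hi]
          exact (hx.2.2 i).trans (mulPow_mono hA hx.1 hle i)
    obtain ⟨i₁, hi₁⟩ := hJ
    -- An index outside `J` has a positive entry whose tail lies in `J`, where `x` was raised, so it
    -- becomes strict.
    obtain ⟨i, hi, j, hj, hpos⟩ := exists_entry_pos hA hirr (I := Jᶜ)
      (Set.nonempty_compl.2 hJu) (fun h => (h ▸ Set.mem_univ i₁ : i₁ ∈ Jᶜ) ((hmemJ i₁).2 hi₁))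
    have hi' : r * y ε i ^ (k + 1) < mulPow A (y ε) i := by
      rw [hout i hi]
      exact (hx.2.2 i).trans_lt
        (mulPow_lt_mulPow hA hx.1 hle hpos fun s => hin _ (not_not.1 (hj s)))
    refine ih _ ?_ hsub ⟨i, hi'⟩ rfl
    exact (Set.ssubset_iff_of_subset fun l hl => hε l hl).2 ⟨i, hi', hi⟩

lemma exists_pos_eigenvector (hn : 1 ≤ n) (hA : ∀ i, 0 ≤ A i) (hirr : ¬ IsReducible A) :
    ∃ (r : ℝ) (x : Fin n → ℝ), (∀ i, 0 < x i) ∧ ∀ i, mulPow A x i = r * x i ^ (k + 1) := by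
  obtain ⟨r, x, hx, hmax⟩ := exists_max_subinvariant hn hA
  suffices h : ∀ i, mulPow A x i = r * x i ^ (k + 1) from
    ⟨r, x, pos_of_nonneg_eigenvector hA hirr hx.1 hx.2.1 h, h⟩
  by_contra! hne
  obtain ⟨i, hi⟩ := hne
  obtain ⟨y, hy, hlt⟩ := hx.exists_strict hA hirr ⟨i, lt_of_le_of_ne (hx.2.2 i) hi.symm⟩
  -- Finitely many strict inequalities leave room for a factor above the maximum.
  have hev : ∀ᶠ s in 𝓝[>] r, ∀ i, s * y i ^ (k + 1) < mulPow A y i := by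
    refine Filter.eventually_all.2 fun i => ?_
    have h1 : Continuous fun s : ℝ => s * y i ^ (k + 1) := by fun_prop
    exact (h1.continuousAt.eventually_lt continuousAt_const (hlt i)).filter_mono nhdsWithin_le_nhds
  obtain ⟨s, hs, hrs⟩ := (hev.and self_mem_nhdsWithin).exists
  exact absurd (hmax s y ⟨hy.1, hy.2.1, fun i => (hs i).le⟩) (not_le.2 hrs)

/-- Every complex eigenvalue is bounded by an eigenvalue with a positive eigenvector. -/
lemma IsEigenpair.norm_le (hA : ∀ i, 0 ≤ A i) {r : ℝ} {x : Fin n → ℝ} (hx : ∀ i, 0 < x i)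
    (h : ∀ i, mulPow A x i = r * x i ^ (k + 1)) {μ : ℂ} {z : Fin n → ℂ}
    (hz : IsEigenpair A μ z) : ‖μ‖ ≤ r := by
  obtain ⟨i₀, hi₀⟩ := Function.ne_iff.1 hz.1
  -- The maximal ratio `c` is the least constant with `|z| ≤ c x`, with equality at `i`.
  obtain ⟨i, -, hi⟩ := Finset.exists_max_image Finset.univ (fun i => ‖z i‖ / x i)
    ⟨i₀, Finset.mem_univ _⟩
  set c := ‖z i‖ / x i with hc
  have hzi : ‖z i‖ = c * x i := by rw [hc, div_mul_cancel₀ _ (hx i).ne']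
  have hcpos : 0 < c :=
    (div_pos (norm_pos_iff.2 hi₀) (hx i₀)).trans_le (hi i₀ (Finset.mem_univ _))
  have h1 : ‖μ‖ * ‖z i‖ ^ (k + 1) ≤ mulPow A (fun i => ‖z i‖) i := by
    rw [← norm_pow, ← norm_mul, ← congrFun hz.2 i, mulPow_real_apply, mulPow]
    refine (norm_sum_le _ _).trans (Finset.sum_le_sum fun j _ => ?_)
    rw [norm_smul, norm_prod, Real.norm_of_nonneg (hA _)]
  have h2 : mulPow A (fun i => ‖z i‖) i ≤ r * ‖z i‖ ^ (k + 1) := by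
    refine (mulPow_mono hA (fun _ => norm_nonneg _) (y := c • x) (fun l => ?_) i).trans_eq ?_
    · exact (div_le_iff₀ (hx l)).1 (hi l (Finset.mem_univ _))
    · rw [mulPow_smul, h, hzi, mul_pow, mul_left_comm]
  exact le_of_mul_le_mul_right (h1.trans h2) (pow_pos (hzi ▸ mul_pos hcpos (hx i)) _)

lemma isEigenpair_ofReal {r : ℝ} {x : Fin n → ℝ} :
    IsEigenpair A (r : ℂ) (fun i => (x i : ℂ)) ↔
      x ≠ 0 ∧ ∀ i, mulPow A x i = r * x i ^ (k + 1) := by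
  have h1 : (fun i => (x i : ℂ)) ≠ 0 ↔ x ≠ 0 := by
    simp [Function.ne_iff]
  have h2 : ∀ i, mulPow A (fun i => (x i : ℂ)) i = ((mulPow A x i : ℝ) : ℂ) := fun i => by
    simp [mulPow]
  rw [IsEigenpair, h1, funext_iff]
  refine and_congr_right fun _ => forall_congr' fun i => ?_
  rw [h2]
  norm_cast

lemma ne_zero_of_pos (hn : 1 ≤ n) {x : Fin n → ℝ} (hx : ∀ i, 0 < x i) : x ≠ 0 :=
  fun h => (hx ⟨0, hn⟩).ne' (congrFun h _)

lemma isSpectralRadius_of_pos_eigenvector (hn : 1 ≤ n) (hA : ∀ i, 0 ≤ A i) {r : ℝ} (hr : 0 ≤ r)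
    {x : Fin n → ℝ} (hx : ∀ i, 0 < x i) (h : ∀ i, mulPow A x i = r * x i ^ (k + 1)) :
    IsSpectralRadius A r := by
  refine ⟨⟨r, fun i => (x i : ℂ), isEigenpair_ofReal.2 ⟨ne_zero_of_pos hn hx, h⟩, ?_⟩, ?_⟩
  · rw [Complex.norm_real, Real.norm_of_nonneg hr]
  · rintro c ⟨μ, z, hz, rfl⟩
    exact hz.norm_le hA hx h

/-- A positive eigenvector is unique up to scaling. -/
lemma exists_eq_smul_of_pos_eigenvectors (hn : 1 ≤ n) (hA : ∀ i, 0 ≤ A i)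
    (hirr : ¬ IsReducible A) {r : ℝ} {x y : Fin n → ℝ} (hx : ∀ i, 0 < x i) (hy : ∀ i, 0 < y i)
    (hxr : ∀ i, mulPow A x i = r * x i ^ (k + 1)) (hyr : ∀ i, mulPow A y i = r * y i ^ (k + 1)) :
    ∃ c : ℝ, 0 < c ∧ x = c • y := by
  obtain ⟨i, -, hi⟩ := Finset.exists_min_image Finset.univ (fun i => x i / y i)
    ⟨⟨0, hn⟩, Finset.mem_univ _⟩
  set c := x i / y i with hc
  have hcpos : 0 < c := div_pos (hx i) (hy i)
  have hle : ∀ l, (c • y) l ≤ x l := fun l => (le_div_iff₀ (hy l)).1 (hi l (Finset.mem_univ _))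
  refine ⟨c, hcpos, ?_⟩
  by_contra hne
  obtain ⟨l, hl, j, hj, hpos⟩ := exists_entry_pos hA hirr (I := {l | x l = (c • y) l})
    ⟨i, by simp [hc, div_mul_cancel₀ _ (hy i).ne']⟩
    (fun hu => hne (funext fun l => (hu ▸ Set.mem_univ l : l ∈ {l | x l = (c • y) l})))
  have := mulPow_lt_mulPow hA (x := c • y) (fun l => (mul_pos hcpos (hy l)).le) hle hpos
    fun s => lt_of_le_of_ne (hle _) (Ne.symm (hj s))
  rw [hxr, show x l = (c • y) l from hl, mulPow_smul, hyr, Pi.smul_apply, smul_eq_mul, mul_pow,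
    mul_left_comm] at this
  exact lt_irrefl _ this

lemma eigenSystem_eq_zero_iff {r : ℝ} {x : Fin n → ℝ} :
    eigenSystem A r x = 0 ↔ (∀ i, mulPow A x i = r * x i ^ (k + 1)) ∧ x ⬝ᵥ x = 1 := by
  simp [eigenSystem, Prod.ext_iff, funext_iff, sub_eq_zero]

/-- Perron–Frobenius for irreducible nonnegative tensors. -/
lemma exists_unique_perronPair (hn : 1 ≤ n) (hA : ∀ i, 0 ≤ A i) (hirr : ¬ IsReducible A)
    (hA0 : A ≠ 0) :
    ∃ p : ℝ × (Fin n → ℝ),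
      {p : ℝ × (Fin n → ℝ) | 0 < p.1 ∧ (∀ i, 0 < p.2 i) ∧ eigenSystem A p.1 p.2 = 0} = {p} ∧
      {q : ℝ × (Fin n → ℝ) | IsPerronPair A q.1 q.2} = {p} := by
  have key : {q : ℝ × (Fin n → ℝ) | IsPerronPair A q.1 q.2} =
      {p | 0 < p.1 ∧ (∀ i, 0 < p.2 i) ∧ eigenSystem A p.1 p.2 = 0} := by
    ext ⟨r, x⟩
    simp only [Set.mem_ofPred_eq, IsPerronPair, isEigenpair_ofReal, eigenSystem_eq_zero_iff]
    constructor
    · rintro ⟨-, ⟨hx0, h⟩, hx, h1⟩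
      have hxpos := pos_of_nonneg_eigenvector hA hirr hx hx0 h
      exact ⟨eigenvalue_pos hA hA0 hxpos h, hxpos, h, h1⟩
    · rintro ⟨hr, hx, h, h1⟩
      exact ⟨isSpectralRadius_of_pos_eigenvector hn hA hr.le hx h, ⟨ne_zero_of_pos hn hx, h⟩,
        fun i => (hx i).le, h1⟩
  obtain ⟨r, y, hy, hyr⟩ := exists_pos_eigenvector hn hA hirr
  have hyy : 0 < y ⬝ᵥ y :=
    Finset.sum_pos (fun i _ => mul_pos (hy i) (hy i)) ⟨⟨0, hn⟩, Finset.mem_univ _⟩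
  set c := (√(y ⬝ᵥ y))⁻¹ with hc
  have hcpos : 0 < c := inv_pos.2 (Real.sqrt_pos.2 hyy)
  have hr := eigenvalue_pos hA hA0 hy hyr
  have hmem : ∀ i, mulPow A (c • y) i = r * (c • y) i ^ (k + 1) := fun i => by
    rw [mulPow_smul, hyr, Pi.smul_apply, smul_eq_mul, mul_pow, mul_left_comm]
  have hunit : (c • y) ⬝ᵥ (c • y) = 1 := by
    rw [smul_dotProduct, dotProduct_smul, smul_eq_mul, smul_eq_mul, ← mul_assoc, hc, ← mul_inv,
      Real.mul_self_sqrt hyy.le, inv_mul_cancel₀ hyy.ne']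
  have hcy : ∀ i, 0 < (c • y) i := fun i => mul_pos hcpos (hy i)
  have hset : {p : ℝ × (Fin n → ℝ) | 0 < p.1 ∧ (∀ i, 0 < p.2 i) ∧ eigenSystem A p.1 p.2 = 0} =
      {(r, c • y)} := by
    ext ⟨s, x⟩
    simp only [Set.mem_ofPred_eq, Set.mem_singleton_iff, eigenSystem_eq_zero_iff, Prod.mk.injEq]
    constructor
    · rintro ⟨hs, hx, h, h1⟩
      -- Both values are the spectral radius.
      obtain rfl : s = r := (isSpectralRadius_of_pos_eigenvector hn hA hs.le hx h).unique
        (isSpectralRadius_of_pos_eigenvector hn hA hr.le hy hyr)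
      obtain ⟨d, hd, rfl⟩ := exists_eq_smul_of_pos_eigenvectors hn hA hirr hx hcy h hmem
      rw [smul_dotProduct, dotProduct_smul, hunit, smul_eq_mul, smul_eq_mul, mul_one] at h1
      have : d = 1 := by nlinarith
      simp [this]
    · rintro ⟨rfl, rfl⟩
      exact ⟨hr, hcy, hmem, hunit⟩
  exact ⟨_, hset, key.trans hset⟩

end Perron

/-! ### The Jacobian of the eigenvalue system and its rank -/

section Jacobian

variable {k n : ℕ} {A : RTensor (k + 2) n}

lemma partialSymm_cons (A : RTensor (k + 2) n) (i : Fin n) (j : Fin (k + 1) → Fin n) :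
    partialSymm A (Fin.cons i j) =
      (1 / (Nat.factorial (k + 1) : ℝ)) *
        ∑ π : Equiv.Perm (Fin (k + 1)), A (Fin.cons i (j ∘ π)) := rfl

lemma partialSymm_cons_comp (A : RTensor (k + 2) n) (i : Fin n) (j : Fin (k + 1) → Fin n)
    (σ : Equiv.Perm (Fin (k + 1))) :
    partialSymm A (Fin.cons i (j ∘ σ)) = partialSymm A (Fin.cons i j) := by
  rw [partialSymm_cons, partialSymm_cons, ← Equiv.sum_comp (Equiv.mulLeft σ) fun π => A (Fin.cons i (j ∘ π))]
  rfl

lemma partialSymm_nonneg (hA : ∀ i, 0 ≤ A i) (l : Fin (k + 2) → Fin n) : 0 ≤ partialSymm A l :=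
  mul_nonneg (by positivity) (Finset.sum_nonneg fun _ _ => hA _)

lemma partialSymm_cons_pos (hA : ∀ i, 0 ≤ A i) {i : Fin n} {j : Fin (k + 1) → Fin n}
    (h : 0 < A (Fin.cons i j)) : 0 < partialSymm A (Fin.cons i j) := by
  rw [partialSymm_cons]
  exact mul_pos (by positivity) (Finset.sum_pos' (fun _ _ => hA _) ⟨1, Finset.mem_univ _, h⟩)

/-- The monomial is symmetric in the summed indices, so averaging over their permutations changes
nothing. -/
lemma mulPow_partialSymm (A : RTensor (k + 2) n) (x : Fin n → ℝ) (i : Fin n) :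
    mulPow (partialSymm A) x i = mulPow A x i := by
  have h : ∀ π : Equiv.Perm (Fin (k + 1)),
      ∑ j : Fin (k + 1) → Fin n, A (Fin.cons i (j ∘ π)) * ∏ s, x (j s) =
        ∑ j : Fin (k + 1) → Fin n, A (Fin.cons i j) * ∏ s, x (j s) := fun π => by
    refine Fintype.sum_equiv (π.symm.arrowCongr (Equiv.refl _)) _ _ fun j => ?_
    congr 1
    exact (Equiv.prod_comp π fun s => x (j s)).symm
  simp only [mulPow_real_apply, partialSymm_cons, mul_assoc, Finset.sum_mul, ← Finset.mul_sum]
  rw [Finset.sum_comm, Finset.sum_congr rfl fun π _ => h π, Finset.sum_const, Finset.card_univ,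
    Fintype.card_perm, Fintype.card_fin, nsmul_eq_mul, ← mul_assoc, one_div,
    inv_mul_cancel₀ (by positivity), one_mul]

lemma mulPowMatrix_mulVec (A : RTensor (k + 2) n) (x v : Fin n → ℝ) (i : Fin n) :
    (mulPowMatrix A x).mulVec v i =
      ∑ j : Fin (k + 1) → Fin n, A (Fin.cons i j) * (v (j 0) * ∏ s : Fin k, x (j s.succ)) := by
  rw [← Equiv.sum_comp (Fin.consEquiv fun _ : Fin (k + 1) => Fin n), Fintype.sum_prod_type]
  simp only [Matrix.mulVec, dotProduct, mulPowMatrix, Matrix.of_apply, Finset.sum_mul]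
  refine Finset.sum_congr rfl fun j _ => Finset.sum_congr rfl fun l _ => ?_
  change _ = A (Fin.cons i (Fin.cons j l)) * (v j * ∏ s, x (l s))
  ring

/-- Swapping slot `s` with slot `0` shows that every term of the product rule is the same; summing
over `s` yields the factor `m - 1`. -/
lemma sum_partialSymm_mul_prod_erase (A : RTensor (k + 2) n) (x v : Fin n → ℝ) (i : Fin n)
    (s : Fin (k + 1)) :
    ∑ j : Fin (k + 1) → Fin n, partialSymm A (Fin.cons i j) *
        ((∏ t ∈ Finset.univ.erase s, x (j t)) * v (j s)) =
      (mulPowMatrix (partialSymm A) x).mulVec v i := by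
  rw [mulPowMatrix_mulVec]
  refine Fintype.sum_equiv ((Equiv.swap 0 s).arrowCongr (Equiv.refl _)) _ _ fun j => ?_
  have hj : (Equiv.swap 0 s).arrowCongr (Equiv.refl (Fin n)) j = j ∘ Equiv.swap 0 s := by
    funext t; simp
  rw [hj, partialSymm_cons_comp, Function.comp_apply, Equiv.swap_apply_left, mul_comm (v (j s))]
  congr 2
  rw [← Finset.prod_image (s := Finset.univ) (f := fun t => x ((j ∘ Equiv.swap 0 s) t))
    (Fin.succ_injective k).injOn]
  refine Finset.prod_bij' (fun t _ => Equiv.swap 0 s t) (fun t _ => Equiv.swap 0 s t) ?_ ?_ ?_ ?_ ?_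
  · intro t ht
    have : Equiv.swap 0 s t ≠ 0 := fun h => Finset.ne_of_mem_erase ht (by
      rw [← Equiv.swap_apply_self 0 s t, h, Equiv.swap_apply_left])
    obtain ⟨u, hu⟩ := Fin.exists_succ_eq.2 this
    exact Finset.mem_image.2 ⟨u, Finset.mem_univ _, hu⟩
  · intro t ht
    obtain ⟨u, -, rfl⟩ := Finset.mem_image.1 ht
    refine Finset.mem_erase.2 ⟨fun h => Fin.succ_ne_zero u ?_, Finset.mem_univ _⟩
    rw [← Equiv.swap_apply_self 0 s u.succ, h, Equiv.swap_apply_right]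
  all_goals simp

/-- The derivative of `x ↦ (A x^{m-1})_i` at `x`. -/
noncomputable def mulPowDeriv (A : RTensor (k + 2) n) (x : Fin n → ℝ) (i : Fin n) : (Fin n → ℝ) →L[ℝ] ℝ :=
  ((k : ℝ) + 1) • ∑ j, mulPowMatrix (partialSymm A) x i j • ContinuousLinearMap.proj j

lemma mulPowDeriv_apply (A : RTensor (k + 2) n) (x v : Fin n → ℝ) (i : Fin n) :
    mulPowDeriv A x i v = ((k : ℝ) + 1) * (mulPowMatrix (partialSymm A) x).mulVec v i := by
  simp [mulPowDeriv, Matrix.mulVec, dotProduct]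

lemma hasFDerivAt_mulPow (A : RTensor (k + 2) n) (x : Fin n → ℝ) (i : Fin n) :
    HasFDerivAt (fun x => mulPow A x i) (mulPowDeriv A x i) x := by
  simp only [← mulPow_partialSymm A, mulPow_real_apply]
  refine (HasFDerivAt.fun_sum fun j _ => (HasFDerivAt.finsetProd
    fun s _ => hasFDerivAt_apply (j s) x).const_mul _).congr_fderiv
    (ContinuousLinearMap.ext fun v => ?_)
  simp only [mulPowDeriv_apply, sum_apply, smul_apply,
    ContinuousLinearMap.proj_apply, smul_eq_mul, Finset.mul_sum]
  rw [Finset.sum_comm]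
  simp [sum_partialSymm_mul_prod_erase]

/-- The derivative of `(r, x) ↦ (A x^{m-1} - r x^{[m-1]}, xᵀ x - 1)` at `p`. -/
noncomputable def eigenSystemDeriv (A : RTensor (k + 2) n) (p : ℝ × (Fin n → ℝ)) :
    ℝ × (Fin n → ℝ) →L[ℝ] (Fin n → ℝ) × ℝ :=
  (ContinuousLinearMap.pi fun i =>
    (mulPowDeriv A p.2 i).comp (ContinuousLinearMap.snd ℝ _ _) -
      (p.2 i ^ (k + 1) • ContinuousLinearMap.fst ℝ _ _ +
        (p.1 * ((k + 1) * p.2 i ^ k)) •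
          (ContinuousLinearMap.proj i).comp (ContinuousLinearMap.snd ℝ _ _))).prod
    (∑ i, (2 * p.2 i) • (ContinuousLinearMap.proj i).comp (ContinuousLinearMap.snd ℝ _ _))

lemma hasFDerivAt_eigenSystem (A : RTensor (k + 2) n) (p : ℝ × (Fin n → ℝ)) :
    HasFDerivAt (fun q : ℝ × (Fin n → ℝ) => eigenSystem A q.1 q.2) (eigenSystemDeriv A p) p := by
  have hc : ∀ i, HasFDerivAt (fun q : ℝ × (Fin n → ℝ) => q.2 i)
      ((ContinuousLinearMap.proj i).comp (ContinuousLinearMap.snd ℝ ℝ (Fin n → ℝ))) p :=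
    fun i => ((ContinuousLinearMap.proj i).comp
      (ContinuousLinearMap.snd ℝ ℝ (Fin n → ℝ))).hasFDerivAt
  refine HasFDerivAt.prodMk (hasFDerivAt_pi.2 fun i => ?_) ?_
  · refine HasFDerivAt.sub ((hasFDerivAt_mulPow A p.2 i).comp p hasFDerivAt_snd) ?_
    refine (hasFDerivAt_fst.mul ((hc i).pow (k + 1))).congr_fderiv
      (ContinuousLinearMap.ext fun v => ?_)
    simp
    ring
  · refine HasFDerivAt.sub_const _ ?_
    refine (HasFDerivAt.fun_sum fun i _ => (hc i).mul (hc i)).congr_fderiv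
      (ContinuousLinearMap.ext fun v => ?_)
    simp only [sum_apply, add_apply, smul_apply, smul_eq_mul]
    exact Finset.sum_congr rfl fun i _ => by ring

lemma jacobian_eigenSystem (A : RTensor (k + 2) n) (p : ℝ × (Fin n → ℝ)) :
    jacobian (fun q => eigenSystem A q.1 q.2) p = jacobianFormula A p.1 p.2 := by
  ext i j
  rw [jacobian, (hasFDerivAt_eigenSystem A p).fderiv, LinearMap.toMatrix_apply]
  rcases i with i | i <;> rcases j with j | j
  · simp [eigenSystemDeriv, jacobianFormula, mulPowDeriv_apply]
  · simp [eigenSystemDeriv, jacobianFormula, mulPowDeriv_apply, Pi.single_apply,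
      Matrix.diagonal_apply]
    split_ifs <;> ring
  · simp [eigenSystemDeriv, jacobianFormula]
  · simp [eigenSystemDeriv, jacobianFormula, Pi.single_apply]

/-- At a positive eigenvector `x` of an irreducible nonnegative tensor, the only solutions `v` of
`Ā x^{m-2} v - r C v = s x^{[m-1]}` are the multiples of `x`, and then `s = 0`. -/
lemma linearized_eigenSystem (hn : 1 ≤ n) (hA : ∀ i, 0 ≤ A i) (hirr : ¬ IsReducible A) {r s : ℝ}
    {x v : Fin n → ℝ} (hx : ∀ i, 0 < x i) (h : ∀ i, mulPow A x i = r * x i ^ (k + 1))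
    (hv : ∀ i, (mulPowMatrix (partialSymm A) x).mulVec v i - r * (x i ^ k * v i) =
      s * x i ^ (k + 1)) :
    s = 0 ∧ ∃ c : ℝ, v = c • x := by
  set w : Fin n → ℝ := fun i => v i / x i with hw
  have hvw : ∀ i, v i = x i * w i := fun i => by rw [hw, mul_div_cancel₀ _ (hx i).ne']
  -- Substituting the eigenvalue equation for `r x^{[m-1]}` leaves a weighted sum of differences of
  -- `w`: nonnegative at a minimizer, nonpositive at a maximizer.
  have hsum : ∀ i, ∑ j : Fin (k + 1) → Fin n, partialSymm A (Fin.cons i j) *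
      ((∏ t, x (j t)) * (w (j 0) - w i)) = s * x i ^ (k + 1) := fun i => by
    have h1 := h i
    rw [← mulPow_partialSymm, mulPow_real_apply] at h1
    rw [← hv i, mulPowMatrix_mulVec, hvw i, show r * (x i ^ k * (x i * w i)) =
      r * x i ^ (k + 1) * w i by ring, ← h1, Finset.sum_mul, ← Finset.sum_sub_distrib]
    refine Finset.sum_congr rfl fun j _ => ?_
    rw [hvw, Fin.prod_univ_succ]
    ring
  have hprod : ∀ j : Fin (k + 1) → Fin n, 0 < ∏ t, x (j t) := fun j =>
    Finset.prod_pos fun t _ => hx _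
  obtain ⟨i₀, -, hmin⟩ := Finset.exists_min_image Finset.univ w ⟨⟨0, hn⟩, Finset.mem_univ _⟩
  obtain ⟨i₁, -, hmax⟩ := Finset.exists_max_image Finset.univ w ⟨⟨0, hn⟩, Finset.mem_univ _⟩
  have hs0 : 0 ≤ s := by
    refine nonneg_of_mul_nonneg_left ?_ (pow_pos (hx i₀) (k + 1))
    rw [← hsum]
    exact Finset.sum_nonneg fun j _ => mul_nonneg (partialSymm_nonneg hA _)
      (mul_nonneg (hprod j).le (sub_nonneg.2 (hmin _ (Finset.mem_univ _))))
  have hs1 : s ≤ 0 := by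
    refine nonpos_of_mul_nonpos_left ?_ (pow_pos (hx i₁) (k + 1))
    rw [← hsum]
    exact Finset.sum_nonpos fun j _ => mul_nonpos_of_nonneg_of_nonpos (partialSymm_nonneg hA _)
      (mul_nonpos_of_nonneg_of_nonpos (hprod j).le (sub_nonpos.2 (hmax _ (Finset.mem_univ _))))
  have hs := le_antisymm hs1 hs0
  refine ⟨hs, w i₀, ?_⟩
  by_contra hne
  -- If `w` is not constant, its minimizers form a proper set; a positive entry leading out of it
  -- makes the sum positive there, contradicting `s = 0`.
  obtain ⟨l, hl, j, hj, hpos⟩ := exists_entry_pos hA hirr (I := {l | w l = w i₀})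
    ⟨i₀, rfl⟩ (fun hu => hne (funext fun l => by
      have hl : w l = w i₀ := (hu ▸ Set.mem_univ l : l ∈ {l | w l = w i₀})
      rw [hvw, hl, Pi.smul_apply, smul_eq_mul, mul_comm]))
  have hl : w l = w i₀ := hl
  have : 0 < s * x l ^ (k + 1) := by
    rw [← hsum]
    refine Finset.sum_pos' (fun j _ => mul_nonneg (partialSymm_nonneg hA _)
      (mul_nonneg (hprod j).le (sub_nonneg.2 (hl ▸ hmin _ (Finset.mem_univ _)))))
      ⟨j, Finset.mem_univ _, mul_pos (partialSymm_cons_pos hA hpos) (mul_pos (hprod j) ?_)⟩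
    exact sub_pos.2 (hl ▸ lt_of_le_of_ne (hmin _ (Finset.mem_univ _)) (Ne.symm (hj 0)))
  simp [hs] at this

lemma rank_jacobianFormula (hn : 1 ≤ n) (hA : ∀ i, 0 ≤ A i) (hirr : ¬ IsReducible A) {r : ℝ}
    {x : Fin n → ℝ} (hx : ∀ i, 0 < x i) (h : eigenSystem A r x = 0) :
    (jacobianFormula A r x).rank = n + 1 := by
  rw [eigenSystem_eq_zero_iff] at h
  have hk : (0 : ℝ) < k + 1 := by positivity
  have hinj : Function.Injective (jacobianFormula A r x).mulVecLin := by
    refine (injective_iff_map_eq_zero _).2 fun u hu => ?_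
    rw [Matrix.mulVecLin_apply, jacobianFormula, Matrix.fromBlocks_mulVec] at hu
    have h1 : ∀ i, -(x i ^ (k + 1)) * u (Sum.inl ()) + ((k : ℝ) + 1) *
        ((mulPowMatrix (partialSymm A) x).mulVec (u ∘ Sum.inr) i -
          r * (x i ^ k * u (Sum.inr i))) = 0 := fun i => by
      have hcol : (Matrix.replicateCol Unit fun i => -(x i ^ (k + 1))).mulVec (u ∘ Sum.inl) i =
          -(x i ^ (k + 1)) * u (Sum.inl ()) := by simp [Matrix.mulVec, dotProduct]
      have := congrFun hu (Sum.inl i)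
      rw [Sum.elim_inl, Pi.add_apply, hcol] at this
      simpa [Matrix.smul_mulVec, Matrix.sub_mulVec, Matrix.mulVec_diagonal] using this
    have h2 : x ⬝ᵥ (u ∘ Sum.inr) = 0 := by
      have := congrFun hu (Sum.inr ())
      simpa [Matrix.mulVec, dotProduct, mul_assoc, ← Finset.mul_sum] using this
    obtain ⟨hs, c, hc⟩ := linearized_eigenSystem hn hA hirr (v := u ∘ Sum.inr)
      (s := u (Sum.inl ()) / (k + 1)) hx h.1 fun i => by
        have := h1 i
        rw [Function.comp_apply]
        field_simp
        linarith
    rw [hc, dotProduct_smul, h.2, smul_eq_mul, mul_one] at h2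
    rw [h2, zero_smul] at hc
    funext l
    rcases l with l | l
    · simpa [hk.ne'] using hs
    · exact congrFun hc l
  rw [Matrix.rank, LinearMap.finrank_range_of_inj hinj]
  simp [add_comm]

end Jacobian

/-! ### Transfer to the homotopy -/

lemma homotopy_eq_eigenSystem {k n : ℕ} (A : RTensor (k + 2) n) (a b : Fin n → ℝ) (r : ℝ)
    (x : Fin n → ℝ) (t : ℝ) :
    homotopy A a b r x t = eigenSystem (pathTensor A a b t) r x := by
  have h : ∀ i, mulPow (pathTensor A a b t) x i =
      t * mulPow A x i + (1 - t) * mulPow (startTensor k a b) x i := fun i => by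
    simp only [mulPow_real_apply, Finset.mul_sum, ← Finset.sum_add_distrib]
    exact Finset.sum_congr rfl fun j _ => by
      simp only [pathTensor, Pi.add_apply, Pi.smul_apply, smul_eq_mul]; ring
  refine Prod.ext (funext fun i => ?_) ?_
  · simp only [homotopy, eigenSystem, h, Prod.fst_add, Prod.smul_fst, Pi.add_apply, Pi.smul_apply,
      smul_eq_mul]
    ring
  · simp only [homotopy, eigenSystem, Prod.snd_add, Prod.smul_snd, smul_eq_mul]
    ring

lemma not_isReducible_of_pos {k n : ℕ} {A : RTensor (k + 2) n} (hA : ∀ i, 0 < A i) :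
    ¬ IsReducible A := by
  rintro ⟨I, ⟨i, hi⟩, hI, h⟩
  obtain ⟨l, hl⟩ := (Set.ne_univ_iff_exists_notMem I).1 hI
  exact (hA _).ne' (h i hi (fun _ => l) fun _ => hl)

lemma exists_perronPair_homotopy {k n : ℕ} (hn : 1 ≤ n) {A : RTensor (k + 2) n}
    {a b : Fin n → ℝ} {t : ℝ} (hB : ∀ i, 0 ≤ pathTensor A a b t i)
    (hirr : ¬ IsReducible (pathTensor A a b t)) (hB0 : pathTensor A a b t ≠ 0) :
    ∃ p : ℝ × (Fin n → ℝ),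
      positiveSolutions A a b t = {p} ∧
      {q : ℝ × (Fin n → ℝ) | IsPerronPair (pathTensor A a b t) q.1 q.2} = {p} ∧
      DifferentiableAt ℝ (fun q : ℝ × (Fin n → ℝ) => homotopy A a b q.1 q.2 t) p ∧
      jacobian (fun q => homotopy A a b q.1 q.2 t) p =
        jacobianFormula (pathTensor A a b t) p.1 p.2 ∧
      (jacobian (fun q => homotopy A a b q.1 q.2 t) p).rank = n + 1 := by
  obtain ⟨p, hp, hperron⟩ := exists_unique_perronPair hn hB hirr hB0
  have hmem : 0 < p.1 ∧ (∀ i, 0 < p.2 i) ∧ eigenSystem (pathTensor A a b t) p.1 p.2 = 0 :=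
    (hp.symm ▸ Set.mem_singleton p :
      p ∈ {p | 0 < p.1 ∧ (∀ i, 0 < p.2 i) ∧ eigenSystem (pathTensor A a b t) p.1 p.2 = 0})
  simp only [positiveSolutions, homotopy_eq_eigenSystem]
  refine ⟨p, hp, hperron, (hasFDerivAt_eigenSystem _ p).differentiableAt,
    jacobian_eigenSystem _ p, ?_⟩
  rw [jacobian_eigenSystem]
  exact rank_jacobianFormula hn hB hirr hmem.2.1 hmem.2.2

end TensorHomotopy

open TensorHomotopy in
theorem lemma2p2 (k n : ℕ) (hn : 1 ≤ n) (A : RTensor (k + 2) n) (hA : ∀ i, 0 ≤ A i)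
    (a b : Fin n → ℝ) (ha : ∀ i, 0 < a i) (hb : ∀ i, 0 < b i) :
    (∀ t : ℝ, 0 ≤ t → t < 1 →
      (∀ i, 0 < pathTensor A a b t i) ∧
      ∃ p : ℝ × (Fin n → ℝ),
        positiveSolutions A a b t = {p} ∧
        {q : ℝ × (Fin n → ℝ) | IsPerronPair (pathTensor A a b t) q.1 q.2} = {p} ∧
        DifferentiableAt ℝ (fun q : ℝ × (Fin n → ℝ) => homotopy A a b q.1 q.2 t) p ∧
        jacobian (fun q => homotopy A a b q.1 q.2 t) p =
          jacobianFormula (pathTensor A a b t) p.1 p.2 ∧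
        (jacobian (fun q => homotopy A a b q.1 q.2 t) p).rank = n + 1) ∧
    (¬ IsReducible A → A ≠ 0 →
      (∀ (r : ℝ) (x : Fin n → ℝ), homotopy A a b r x 1 = eigenSystem A r x) ∧
      ∃ p : ℝ × (Fin n → ℝ),
        positiveSolutions A a b 1 = {p} ∧
        {q : ℝ × (Fin n → ℝ) | IsPerronPair A q.1 q.2} = {p} ∧
        DifferentiableAt ℝ (fun q : ℝ × (Fin n → ℝ) => homotopy A a b q.1 q.2 1) p ∧
        jacobian (fun q => homotopy A a b q.1 q.2 1) p = jacobianFormula A p.1 p.2 ∧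
        (jacobian (fun q => homotopy A a b q.1 q.2 1) p).rank = n + 1) := by
  have h1 : pathTensor A a b 1 = A := by simp [pathTensor]
  refine ⟨fun t ht0 ht1 => ?_, fun hirr hA0 => ?_⟩
  · have hpos : ∀ i, 0 < pathTensor A a b t i := fun i =>
      add_pos_of_nonneg_of_pos (mul_nonneg ht0 (hA i)) (mul_pos (sub_pos.2 ht1)
        (mul_pos (pow_pos (ha _) _) (Finset.prod_pos fun s _ => hb _)))
    refine ⟨hpos, exists_perronPair_homotopy hn (fun i => (hpos i).le)
      (not_isReducible_of_pos hpos) fun h => ?_⟩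
    -- A positive tensor is nonzero only because `n ≥ 1` provides an entry.
    exact (hpos fun _ => ⟨0, hn⟩).ne' (congrFun h _)
  · refine ⟨fun r x => by rw [homotopy_eq_eigenSystem, h1], ?_⟩
    have := exists_perronPair_homotopy hn (A := A) (a := a) (b := b) (t := 1)
      (by rwa [h1]) (by rwa [h1]) (by rwa [h1])
    rwa [h1] at this
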